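/- A two-counter machine $\mathcal M$ is a finite sequence $(l_1,\dots,l_n)$ of commands over two counters $x,y$ with values in $\mathbb N$. For a counter $c\in\{x,y\}$ and locations $k,k'\in\{1,\dots,n\}$, each command has one of the forms $\mathrm{inc}(c)$, $\mathrm{dec}(c)$, $\mathrm{goto}\ l_k$, "if $c=0$ goto $l_k$ else goto $l_{k'}$", or $\mathrm{halt}$. Every command $l_i=\mathrm{dec}(c)$ is immediately preceded by $l_{i-1}=$ "if $c=0$ goto $l_{i-1}$ else goto $l_i$", and no other command jumps to location $i$. The machine starts in location $1$ with both counters $0$; after $\mathrm{inc}$ and $\mathrm{dec}$ it continues in the next location (there is no next configuration if there is no next location), and it stops at $\mathrm{halt}$. It $0$-halts if its run reaches a $\mathrm{halt}$ command with both counters equal to $0$. An NMDA (nondeterministic discounted-sum automaton with multiple discount factors) is a tuple $\mathcal A=\langle\Sigma,Q,\iota,\delta,\gamma,\rho\rangle$ with a finite alphabet $\Sigma$, a finite set of states $Q$, initial states $\iota\subseteq Q$, transitions $\delta\subseteq Q\times\Sigma\times Q$, weights $\gamma:\delta\to\mathbb Q$ and discount factors $\rho:\delta\to\mathbb Q\cap(1,\infty)$.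 It is integral if all its discount factors are integers. It is deterministic (a DMDA) if $|\iota|=1$ and for every $q\in Q$ and $\sigma\in\Sigma$ there is at most one $q'$ with $(q,\sigma,q')\in\delta$. A run $r$ on a finite word $\sigma_0\cdots\sigma_{m-1}$ is a sequence of states $p_0,\dots,p_m$ with $p_0\in\iota$ and $r[i]=(p_i,\sigma_i,p_{i+1})\in\delta$ for all $i<m$; its value is $\sum_{i=0}^{m-1}\gamma(r[i])\prod_{j=0}^{i-1}\frac1{\rho(r[j])}$. The value $\mathcal A(w)$ is the infimum of the values of the runs of $\mathcal A$ on $w$ (and $+\infty$ if there is no run). **Lemma.** There is an algorithm (a computable function) that, given a two-counter machine $\mathcal M$, outputs an integral DMDA $\mathcal A$ and an integral NMDA $\mathcal B$ over a common finite alphabet $\Sigma$ such that the following three statements are equivalent: 1. $\mathcal M$ $0$-halts; 2. there is a nonempty finite word $w\in\Sigma^+$ with $\mathcal B(w)\ge\mathcal A(w)$; 3. there is a nonempty finite word $w\in\Sigma^+$ with $\mathcal B(w)>\mathcal A(w)$. -/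

import Mathlib

/-! ## Discounted-sum automata with multiple discount factors -/

/-- A nondeterministic discounted-sum automaton with multiple discount factors (NMDA): a tuple of a
finite alphabet, a finite set of states, a set of initial states, a transition relation `δ`, a
rational weight and a rational discount factor greater than one on every transition. The values of
`weight` and `discount` outside of `δ` play no role. -/
structure NMDA (Λ S : Type*) where
  alphabet : Finset Λ
  states : Finset S
  initial : Finset S
  δ : Finset (S × Λ × S)
  weight : S × Λ × S → ℚ
  discount : S × Λ × S → ℚ
  initial_subset : initial ⊆ states
  mem_of_mem_δ : ∀ p a q, (p, a, q) ∈ δ → p ∈ states ∧ a ∈ alphabet ∧ q ∈ states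
  one_lt_discount : ∀ t ∈ δ, 1 < discount t

namespace NMDA

variable {Λ S : Type*}

/-- All discount factors are integers. -/
def IsIntegral (A : NMDA Λ S) : Prop :=
  ∀ t ∈ A.δ, ∃ k : ℤ, A.discount t = k

/-- One initial state, and at most one successor for every state and letter. An NMDA that is
deterministic is a DMDA. -/
def IsDeterministic (A : NMDA Λ S) : Prop :=
  A.initial.card = 1 ∧ ∀ p a q q', (p, a, q) ∈ A.δ → (p, a, q') ∈ A.δ → q = q'

/-- The `i`-th transition of the state sequence `p` along the word `w`. -/
def transition (w : List Λ) (p : Fin (w.length + 1) → S) (i : Fin w.length) : S × Λ × S :=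
  (p i.castSucc, w.get i, p i.succ)

/-- The state sequence `p` is a run of `A` on the finite word `w`. -/
def IsRunOn (A : NMDA Λ S) (w : List Λ) (p : Fin (w.length + 1) → S) : Prop :=
  p 0 ∈ A.initial ∧ ∀ i, transition w p i ∈ A.δ

/-- The value of a run: the sum of the weights of its transitions, each one divided by the product
of the discount factors of the transitions that come before it. -/
def runValue (A : NMDA Λ S) (w : List Λ) (p : Fin (w.length + 1) → S) : ℚ :=
  ∑ i, A.weight (transition w p i) * ∏ j ∈ Finset.Iio i, 1 / A.discount (transition w p j)

/-- The value of `A` on a finite word: the infimum of the values of its runs on the word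
(`⊤` if there is no run). -/
noncomputable def value (A : NMDA Λ S) (w : List Λ) : EReal :=
  ⨅ (p : Fin (w.length + 1) → S) (_ : A.IsRunOn w p), ((A.runValue w p : ℝ) : EReal)

/-- `w` is a nonempty finite word over the alphabet of `A`. -/
def IsNonemptyWord (A : NMDA Λ S) (w : List Λ) : Prop :=
  w ≠ [] ∧ ∀ a ∈ w, a ∈ A.alphabet

end NMDA

/-- Finite descriptions of NMDAs whose letters and states are named by natural numbers: the lists of
the letters, of the states, of the initial states, and of the transitions. A transition is written
as (source, letter, target, weight, discount factor), with a rational number written as the pair of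
its numerator and its denominator in lowest terms. -/
abbrev NMDACode : Type :=
  List ℕ × List ℕ × List ℕ × List (ℕ × ℕ × ℕ × (ℤ × ℕ) × (ℤ × ℕ))

/-- The description `d` is a description of the automaton `A`. -/
def NMDACode.Describes (d : NMDACode) (A : NMDA ℕ ℕ) : Prop :=
  (∀ a, a ∈ d.1 ↔ a ∈ A.alphabet) ∧
  (∀ q, q ∈ d.2.1 ↔ q ∈ A.states) ∧
  (∀ q, q ∈ d.2.2.1 ↔ q ∈ A.initial) ∧
  ∀ e, e ∈ d.2.2.2 ↔ ∃ p a q, (p, a, q) ∈ A.δ ∧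
    e = (p, a, q, ((A.weight (p, a, q)).num, (A.weight (p, a, q)).den),
      ((A.discount (p, a, q)).num, (A.discount (p, a, q)).den))

/-! ## Two-counter machines -/

namespace CounterMachine

/-- The two counters. -/
inductive Counter
  | x
  | y
  deriving DecidableEq

/-- The commands of a two-counter machine: increment, decrement, unconditional jump, and
`jz c k k'`: if `c = 0` then go to `k`, else go to `k'`, and halt. -/
inductive Command
  | inc (c : Counter)
  | dec (c : Counter)
  | goto (k : ℕ)
  | jz (c : Counter) (k k' : ℕ)
  | halt
  deriving DecidableEq

/-- Counters as Booleans. -/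
def counterEquiv : Counter ≃ Bool where
  toFun c := match c with
    | .x => false
    | .y => true
  invFun b := match b with
    | false => .x
    | true => .y
  left_inv c := by cases c <;> rfl
  right_inv b := by cases b <;> rfl

instance : Primcodable Counter := Primcodable.ofEquiv Bool counterEquiv

/-- Commands as elements of a sum of product types. -/
def commandEquiv :
    Command ≃ Counter ⊕ Counter ⊕ ℕ ⊕ (Counter × ℕ × ℕ) ⊕ Unit where
  toFun l := match l with
    | .inc c => .inl c
    | .dec c => .inr (.inl c)
    | .goto k => .inr (.inr (.inl k))
    | .jz c k k' => .inr (.inr (.inr (.inl (c, k, k'))))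
    | .halt => .inr (.inr (.inr (.inr ())))
  invFun s := match s with
    | .inl c => .inc c
    | .inr (.inl c) => .dec c
    | .inr (.inr (.inl k)) => .goto k
    | .inr (.inr (.inr (.inl (c, k, k')))) => .jz c k k'
    | .inr (.inr (.inr (.inr ()))) => .halt
  left_inv l := by cases l <;> rfl
  right_inv s := by rcases s with c | c | k | ⟨c, k, k'⟩ | u <;> rfl

instance : Primcodable Command := Primcodable.ofEquiv _ commandEquiv

/-- The list of commands `M` is a two-counter machine; its locations are `0, …, M.length - 1`, and
`M[i]?` is the command in location `i`. All jumps lead to locations of the machine. Every command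
`dec c` in a location `i` directly follows, in the list, the command `jz c (i - 1) i`, and no other
command jumps to it. -/
structure IsTwoCounterMachine (M : List Command) : Prop where
  goto_lt : ∀ k, Command.goto k ∈ M → k < M.length
  jz_lt : ∀ c k k', Command.jz c k k' ∈ M → k < M.length ∧ k' < M.length
  dec_guarded : ∀ i c, M[i]? = some (Command.dec c) →
    ∃ j, i = j + 1 ∧ M[j]? = some (Command.jz c j i) ∧
      ∀ j', j' ≠ j → M[j']? ≠ some (Command.goto i) ∧
        ∀ c' k k', M[j']? = some (Command.jz c' k k') → k ≠ i ∧ k' ≠ i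

/-- A configuration: a location and the values of the two counters. -/
abbrev Config : Type := ℕ × (Counter → ℕ)

/-- One step of the machine. There is no step from a `halt` command. -/
inductive Step (M : List Command) : Config → Config → Prop
  | inc {i : ℕ} {v : Counter → ℕ} {c : Counter} (h : M[i]? = some (Command.inc c))
      (hi : i + 1 < M.length) : Step M (i, v) (i + 1, Function.update v c (v c + 1))
  | dec {i : ℕ} {v : Counter → ℕ} {c : Counter} (h : M[i]? = some (Command.dec c))
      (hi : i + 1 < M.length) (hv : 0 < v c) :
      Step M (i, v) (i + 1, Function.update v c (v c - 1))
  | goto {i k : ℕ} {v : Counter → ℕ} (h : M[i]? = some (Command.goto k)) : Step M (i, v) (k, v)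
  | jz_zero {i k k' : ℕ} {v : Counter → ℕ} {c : Counter}
      (h : M[i]? = some (Command.jz c k k')) (hv : v c = 0) : Step M (i, v) (k, v)
  | jz_pos {i k k' : ℕ} {v : Counter → ℕ} {c : Counter}
      (h : M[i]? = some (Command.jz c k k')) (hv : 0 < v c) : Step M (i, v) (k', v)

/-- A run of `M`: it starts in the first location with both counters equal to zero, and successive
configurations are related by a step of the machine. -/
def IsRun (M : List Command) (r : List Config) : Prop :=
  0 < M.length ∧ r.head? = some (0, fun _ => 0) ∧ r.IsChain (Step M)

/-- `M` has a run that ends in a `halt` command with both counters equal to zero. -/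
def ZeroHalts (M : List Command) : Prop :=
  ∃ (r : List Config) (j : ℕ), IsRun M r ∧ r.getLast? = some (j, fun _ => 0) ∧
    M[j]? = some Command.halt

end CounterMachine

/-! If every transition with discount factor `d` has weight `1 / d - 1`, the value of a run
telescopes to `1 / D - 1`, where `D` is the product of its discount factors
(`runValue_ofExponents`). Take `d = 2 ^ (k + 1)` with `k < 5`, and let `s` be the sum of the numbers
`k - 2` along a run on a word of length `n`. The run then has value `2 ^ (-(3 * n + s)) - 1`, so the
infimum picks out the largest `s`. The deterministic automaton A has one state and always `s = 0`.
Hence B(w) ≥ A(w) means that all runs of B on `w` have `s ≤ 0`, and B(w) > A(w) that all have `s ≤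
-1`.

Words are sequences of control edges of the machine, and B bets on an error in them. One run checks
the path: it gains 1 at the start and loses 2 at a halt. So it ends with `s = 1` if the path breaks
or stops before a halt, and also if a letter follows the halt, which restores the 2. For each
counter, with current value `n`, two further states accumulate `2 * n` and `-2 * n`. The first may
exit with -1 at a zero test or a halt, for a total of `2 * n - 1`; the second may exit with +1 at a
positivity test or a decrement, for a total of `1 - 2 * n`. Such a total is at least 1 if the
counter violates the edge, and at most -1 otherwise.

An encoding of a 0-halting run therefore has only runs with `s ≤ -1` (`exists_word_of_zeroHalts`),
while any other nonempty word has a run with `s ≥ 1` (`zeroHalts_of_word`). The absence of totals in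
between makes the strict and the weak comparison equivalent. -/

/-! ## Automata whose weights and discount factors are given by exponents -/

/-- A run of the automaton with exponents `e` and states below `N` that starts in a given state and
reads a given word; the last argument is the sum of its exponents, each one diminished by two. -/
inductive ExponentRun (N : ℕ) (e : ℕ → ℕ → ℕ → Option (Fin 5)) : ℕ → List ℕ → ℤ → Prop
  | nil (p : ℕ) : ExponentRun N e p [] 0
  | cons {p a q : ℕ} {k : Fin 5} {w : List ℕ} {s : ℤ} (he : e p a q = some k) (hq : q < N)
      (h : ExponentRun N e q w s) : ExponentRun N e p (a :: w) (s + ((k : ℕ) - 2))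

theorem ExponentRun.cons' {N : ℕ} {e : ℕ → ℕ → ℕ → Option (Fin 5)} {p a q : ℕ} {k : Fin 5}
    {w : List ℕ} {s t : ℤ} (he : e p a q = some k) (hq : q < N) (h : ExponentRun N e q w s)
    (ht : t = s + ((k : ℕ) - 2)) : ExponentRun N e p (a :: w) t :=
  ht ▸ .cons he hq h

theorem exponentRun_cons_iff {N : ℕ} {e : ℕ → ℕ → ℕ → Option (Fin 5)} {p a : ℕ} {w : List ℕ}
    {t : ℤ} : ExponentRun N e p (a :: w) t ↔ ∃ q k, e p a q = some k ∧ q < N ∧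
      ExponentRun N e q w (t - ((k : ℕ) - 2)) := by
  constructor
  · rintro (_ | ⟨he, hq, h⟩)
    exact ⟨_, _, he, hq, by simpa using h⟩
  · rintro ⟨q, k, he, hq, h⟩
    exact .cons' he hq h (by ring)

theorem exponentRun_nil_iff {N : ℕ} {e : ℕ → ℕ → ℕ → Option (Fin 5)} {p : ℕ} {t : ℤ} :
    ExponentRun N e p [] t ↔ t = 0 := by
  constructor
  · rintro ⟨⟩
    rfl
  · rintro rfl
    exact .nil p

namespace NMDA

/-- The discount factor with exponent `k`. -/
def expDiscount (k : Fin 5) : ℚ := 2 ^ ((k : ℕ) + 1)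

theorem one_lt_expDiscount (k : Fin 5) : 1 < expDiscount k :=
  one_lt_pow₀ one_lt_two (Nat.succ_ne_zero _)

/-- The automaton with letters below `L`, states below `N`, initial states `I`, and the transitions
`(p, a, q)` with `e p a q = some k`. Such a transition has discount factor `d = 2 ^ (k + 1)` and
weight `1 / d - 1`, so that a run has value `1 / D - 1` for the product `D` of its discount
factors. -/
def ofExponents (L N : ℕ) (I : List ℕ) (e : ℕ → ℕ → ℕ → Option (Fin 5))
    (hI : ∀ p ∈ I, p < N) : NMDA ℕ ℕ where
  alphabet := Finset.range L
  states := Finset.range N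
  initial := I.toFinset
  δ := {t ∈ Finset.range N ×ˢ Finset.range L ×ˢ Finset.range N | (e t.1 t.2.1 t.2.2).isSome}
  weight t := 1 / expDiscount ((e t.1 t.2.1 t.2.2).getD 0) - 1
  discount t := expDiscount ((e t.1 t.2.1 t.2.2).getD 0)
  initial_subset p hp := by simpa using hI p (by simpa using hp)
  mem_of_mem_δ p a q h := by
    simp only [Finset.mem_filter, Finset.mem_product] at h
    exact h.1
  one_lt_discount _ _ := one_lt_expDiscount _

/-- The weight and the discount factor with exponent `k`, as pairs of a numerator and a
denominator. -/
def exponentEntry (k : Fin 5) : (ℤ × ℕ) × (ℤ × ℕ) :=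
  (((1 / expDiscount k - 1).num, (1 / expDiscount k - 1).den),
    ((expDiscount k).num, (expDiscount k).den))

/-- The description of `NMDA.ofExponents`. -/
def exponentCode (L N : ℕ) (I : List ℕ) (e : ℕ → ℕ → ℕ → Option (Fin 5)) : NMDACode :=
  (List.range L, List.range N, I,
    (List.range N).flatMap fun p => (List.range L).flatMap fun a => (List.range N).filterMap fun q =>
      (e p a q).map fun k => (p, a, q, exponentEntry k))

/-! ### Run values as powers of two -/

section

variable {L N : ℕ} {I : List ℕ} {e : ℕ → ℕ → ℕ → Option (Fin 5)} {hI : ∀ p ∈ I, p < N}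

theorem mem_δ_ofExponents {p a q : ℕ} :
    (p, a, q) ∈ (ofExponents L N I e hI).δ ↔
      p < N ∧ a < L ∧ q < N ∧ ∃ k, e p a q = some k := by
  simp [ofExponents, Option.isSome_iff_exists, and_assoc]

theorem exponentCode_describes :
    (exponentCode L N I e).Describes (ofExponents L N I e hI) := by
  refine ⟨by simp [exponentCode, ofExponents], by simp [exponentCode, ofExponents],
    by simp [exponentCode, ofExponents], fun t => ?_⟩
  simp only [exponentCode, List.mem_flatMap, List.mem_range, List.mem_filterMap,
    Option.map_eq_some_iff, mem_δ_ofExponents]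
  constructor
  · rintro ⟨p, hp, a, ha, q, hq, k, hk, rfl⟩
    exact ⟨p, a, q, ⟨hp, ha, hq, k, hk⟩, by simp [ofExponents, hk, exponentEntry]⟩
  · rintro ⟨p, a, q, ⟨hp, ha, hq, k, hk⟩, rfl⟩
    exact ⟨p, hp, a, ha, q, hq, k, hk, by simp [ofExponents, hk, exponentEntry]⟩

theorem ofExponents_isIntegral : (ofExponents L N I e hI).IsIntegral := fun _ _ =>
  ⟨2 ^ (((e _ _ _).getD 0 : ℕ) + 1), by simp only [ofExponents, expDiscount]; push_cast; rfl⟩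

/-- Each weight is the discount step itself: with `P` the product of the inverse discounts so far,
the summand is `P / d - P`, and the sum telescopes. -/
theorem runValue_ofExponents (w : List ℕ) (r : Fin (w.length + 1) → ℕ) :
    (ofExponents L N I e hI).runValue w r =
      ∏ i, 1 / (ofExponents L N I e hI).discount (transition w r i) - 1 := by
  -- The telescoping identity for `∏ (1 - f i)`, applied to `f i = 1 - 1 / d i`, the negated weight.
  have h := Finset.prod_one_sub_ordered Finset.univ
    fun i => 1 - 1 / (ofExponents L N I e hI).discount (transition w r i)
  simp only [sub_sub_cancel] at h
  rw [h, runValue, sub_sub_cancel_left, ← Finset.sum_neg_distrib]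
  refine Finset.sum_congr rfl fun i _ => ?_
  rw [← neg_mul]
  congr 1
  · simp [ofExponents]
  · exact Finset.prod_congr (by ext; simp) fun _ _ => rfl

theorem exists_exponentRun_of_isRun (w : List ℕ) : ∀ r : Fin (w.length + 1) → ℕ,
    (∀ i, transition w r i ∈ (ofExponents L N I e hI).δ) →
    ∃ s, ExponentRun N e (r 0) w s ∧
      ∏ i, 1 / (ofExponents L N I e hI).discount (transition w r i) =
        (2 : ℚ) ^ (-(3 * w.length + s)) := by
  induction w with
  | nil => exact fun r _ => ⟨0, .nil _, by simp⟩
  | cons a w ih =>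
    intro r hr
    obtain ⟨s, hs, hp⟩ := ih (fun i => r i.succ) fun i => hr i.succ
    obtain ⟨-, -, hq, k, hk⟩ := mem_δ_ofExponents.1 (hr 0)
    refine ⟨s + ((k : ℕ) - 2), .cons hk hq hs, ?_⟩
    have h0 : (ofExponents L N I e hI).discount (transition (a :: w) r 0) = expDiscount k :=
      congrArg (fun o => expDiscount (Option.getD o 0)) hk
    refine (Fin.prod_univ_succ _).trans ?_
    rw [h0]
    refine (congrArg _ hp).trans ?_
    rw [expDiscount, one_div, ← zpow_natCast, ← zpow_neg, ← zpow_add₀ two_ne_zero]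
    congr 1
    push_cast [List.length_cons]
    ring

theorem exists_isRun_of_exponentRun {p : ℕ} {w : List ℕ} {s : ℤ} (h : ExponentRun N e p w s) :
    p < N → (∀ a ∈ w, a < L) → ∃ r : Fin (w.length + 1) → ℕ, r 0 = p ∧
      (∀ i, transition w r i ∈ (ofExponents L N I e hI).δ) ∧
      ∏ i, 1 / (ofExponents L N I e hI).discount (transition w r i) =
        (2 : ℚ) ^ (-(3 * w.length + s)) := by
  induction h with
  | nil p => exact fun _ _ => ⟨fun _ => p, rfl, fun i => i.elim0, by simp⟩
  | @cons p a q k w s he hq h ih =>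
    intro hp hw
    obtain ⟨r, h0, hr, hv⟩ := ih hq fun b hb => hw b (List.mem_cons_of_mem _ hb)
    have ht0 : transition (a :: w) (Fin.cons p r : Fin ((w.length + 1) + 1) → ℕ) 0 = (p, a, q) := by
      rw [← h0]; rfl
    have ht : ∀ i : Fin w.length,
        transition (a :: w) (Fin.cons p r : Fin ((w.length + 1) + 1) → ℕ) i.succ =
          transition w r i := fun i => rfl
    refine ⟨(Fin.cons p r : Fin ((w.length + 1) + 1) → ℕ), rfl, fun i => ?_, ?_⟩
    · refine Fin.cases ?_ (fun i => ?_) i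
      · rw [ht0]
        exact mem_δ_ofExponents.2 ⟨hp, hw a List.mem_cons_self, hq, k, he⟩
      · rw [ht]
        exact hr i
    · have h0 : (ofExponents L N I e hI).discount (p, a, q) = expDiscount k :=
        congrArg (fun o => expDiscount (Option.getD o 0)) he
      refine (Fin.prod_univ_succ _).trans ?_
      rw [ht0, h0]
      refine (congrArg _ hv).trans ?_
      rw [expDiscount, one_div, ← zpow_natCast, ← zpow_neg, ← zpow_add₀ two_ne_zero]
      congr 1
      push_cast [List.length_cons]
      ring

/-- A larger exponent sum makes a run cheaper, so an upper bound on sums is a lower bound on the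
value; it also covers words without a run, of value `⊤`. -/
theorem le_value_ofExponents {w : List ℕ} {m : ℤ}
    (h : ∀ p ∈ I, ∀ s, ExponentRun N e p w s → s ≤ m) :
    ((((2 : ℚ) ^ (-(3 * w.length + m)) - 1 : ℚ) : ℝ) : EReal) ≤
      (ofExponents L N I e hI).value w := by
  refine le_iInf₂ fun r hr => ?_
  obtain ⟨s, hs, hv⟩ := exists_exponentRun_of_isRun w r hr.2
  rw [runValue_ofExponents, hv, EReal.coe_le_coe_iff, Rat.cast_le, sub_le_sub_iff_right]
  have := h _ (by simpa [ofExponents] using hr.1) s hs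
  exact zpow_le_zpow_right₀ one_le_two (by lia)

theorem value_ofExponents_le {w : List ℕ} {m s : ℤ} {p : ℕ} (hp : p ∈ I) (hw : ∀ a ∈ w, a < L)
    (h : ExponentRun N e p w s) (hm : m ≤ s) :
    (ofExponents L N I e hI).value w ≤
      ((((2 : ℚ) ^ (-(3 * w.length + m)) - 1 : ℚ) : ℝ) : EReal) := by
  obtain ⟨r, h0, hr, hv⟩ := exists_isRun_of_exponentRun (I := I) (hI := hI) h (hI p hp) hw
  refine (iInf₂_le r ⟨by simpa [ofExponents, h0] using hp, hr⟩).trans ?_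
  rw [runValue_ofExponents, hv, EReal.coe_le_coe_iff, Rat.cast_le, sub_le_sub_iff_right]
  exact zpow_le_zpow_right₀ one_le_two (by lia)

end

/-- The deterministic automaton with one state and all discount factors equal to eight. -/
def constant (L : ℕ) : NMDA ℕ ℕ :=
  ofExponents L 1 [0] (fun _ _ _ => some 2) (by simp)

theorem constant_isDeterministic (L : ℕ) : (constant L).IsDeterministic := by
  refine ⟨by simp [constant, ofExponents], fun p a q q' h h' => ?_⟩
  have h1 := (mem_δ_ofExponents.1 h).2.2.1
  have h2 := (mem_δ_ofExponents.1 h').2.2.1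
  lia

theorem value_constant {L : ℕ} {w : List ℕ} (hw : ∀ a ∈ w, a < L) :
    (constant L).value w = ((((2 : ℚ) ^ (-(3 * w.length + 0 : ℤ)) - 1 : ℚ) : ℝ) : EReal) := by
  have hle : ∀ (w : List ℕ) (p : ℕ) (s : ℤ),
      ExponentRun 1 (fun _ _ _ => some 2) p w s → s ≤ 0 := by
    intro w p s h
    induction h with
    | nil p => rfl
    | cons he hq h ih => cases he; simpa using ih
  have hex : ∀ w : List ℕ, ExponentRun 1 (fun _ _ _ => some 2) 0 w 0 := by
    intro w
    induction w with
    | nil => exact .nil 0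
    | cons a w ih => exact .cons' rfl one_pos ih (by simp)
  exact le_antisymm (value_ofExponents_le (by simp) hw (hex w) le_rfl)
    (le_value_ofExponents fun p _ s h => hle w p s h)

/-! ### Comparison with the constant automaton -/

section

variable {L N : ℕ} {I : List ℕ} {e : ℕ → ℕ → ℕ → Option (Fin 5)} {hI : ∀ p ∈ I, p < N}

theorem value_constant_lt_value_ofExponents {w : List ℕ} (hw : ∀ a ∈ w, a < L)
    (h : ∀ p ∈ I, ∀ s, ExponentRun N e p w s → s ≤ -1) :
    (constant L).value w < (ofExponents L N I e hI).value w := by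
  refine lt_of_lt_of_le ?_ (le_value_ofExponents h)
  rw [value_constant hw, EReal.coe_lt_coe_iff, Rat.cast_lt, sub_lt_sub_iff_right]
  exact zpow_lt_zpow_right₀ one_lt_two (by lia)

theorem le_zero_of_value_constant_le {w : List ℕ} (hw : ∀ a ∈ w, a < L)
    (h : (constant L).value w ≤ (ofExponents L N I e hI).value w) {p : ℕ} (hp : p ∈ I) {s : ℤ}
    (hs : ExponentRun N e p w s) : s ≤ 0 := by
  by_contra! hlt
  have := h.trans (value_ofExponents_le hp hw hs (m := 1) hlt)
  rw [value_constant hw, EReal.coe_le_coe_iff, Rat.cast_le, sub_le_sub_iff_right,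
    zpow_le_zpow_iff_right₀ one_lt_two] at this
  lia

end

end NMDA

namespace CounterMachine

/-! ## Control edges of a two-counter machine -/

/-- The effect of a control edge on the counters. -/
inductive Op
  | inc (c : Counter)
  | dec (c : Counter)
  | skip
  | isZero (c : Counter)
  | isPos (c : Counter)
  | halt

/-- Operations as elements of a sum of product types. -/
def opEquiv : Op ≃ (Fin 4 × Counter) ⊕ Bool where
  toFun o := match o with
    | .inc c => .inl (0, c)
    | .dec c => .inl (1, c)
    | .isZero c => .inl (2, c)
    | .isPos c => .inl (3, c)
    | .skip => .inr false
    | .halt => .inr true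
  invFun s := match s with
    | .inl (0, c) => .inc c
    | .inl (1, c) => .dec c
    | .inl (2, c) => .isZero c
    | .inl (3, c) => .isPos c
    | .inr false => .skip
    | .inr true => .halt
  left_inv o := by cases o <;> rfl
  right_inv s := by rcases s with ⟨i, c⟩ | b <;> [fin_cases i; cases b] <;> rfl

instance : Primcodable Op := Primcodable.ofEquiv _ opEquiv

instance : Finite Counter := Finite.of_equiv _ counterEquiv.symm

instance : Finite Op := Finite.of_equiv _ opEquiv.symm

/-- The control edges that leave location `i` with a given command: source, target and
operation. -/
def commandEdges (i : ℕ) : Command → List (ℕ × ℕ × Op)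
  | .inc c => [(i, i + 1, .inc c)]
  | .dec c => [(i, i + 1, .dec c)]
  | .goto k => [(i, k, .skip)]
  | .jz c k k' => [(i, k, .isZero c), (i, k', .isPos c)]
  | .halt => [(i, i, .halt)]

/-- The control edges of a machine. -/
def edges (M : List Command) : List (ℕ × ℕ × Op) :=
  (List.range M.length).flatMap fun i => M[i]?.elim [] (commandEdges i)

theorem mem_edges {M : List Command} {i t : ℕ} {o : Op} :
    (i, t, o) ∈ edges M ↔ ∃ l, M[i]? = some l ∧ (i, t, o) ∈ commandEdges i l := by
  simp only [edges, List.mem_flatMap, List.mem_range]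
  constructor
  · rintro ⟨j, hj, h⟩
    rw [List.getElem?_eq_getElem hj] at h
    obtain rfl : i = j := by
      cases hl : M[j] <;> simp [hl, commandEdges] at h <;> lia
    exact ⟨_, List.getElem?_eq_getElem hj, h⟩
  · rintro ⟨l, hl, h⟩
    exact ⟨i, (List.getElem?_eq_some_iff.1 hl).1, by simpa [hl] using h⟩

/-- The bound is not strict: an increment or decrement in the last location points just past the
end. This extra location has its own state but no outgoing edges. -/
theorem target_le_of_mem_edges {M : List Command} (hM : IsTwoCounterMachine M) {i t : ℕ} {o : Op}
    (h : (i, t, o) ∈ edges M) : t ≤ M.length := by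
  obtain ⟨l, hl, h⟩ := mem_edges.1 h
  have hi : i < M.length := (List.getElem?_eq_some_iff.1 hl).1
  have hmem : l ∈ M := List.mem_of_getElem? hl
  cases l with
  | inc c => simp [commandEdges] at h; lia
  | dec c => simp [commandEdges] at h; lia
  | goto k => have := hM.goto_lt k hmem; simp [commandEdges] at h; lia
  | jz c k k' =>
    have := hM.jz_lt c k k' hmem
    simp [commandEdges] at h
    lia
  | halt => simp [commandEdges] at h; lia

/-- The change of the counters by an operation that is not a halt. -/
inductive Op.Fires (v : Counter → ℕ) : Op → (Counter → ℕ) → Prop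
  | inc (c : Counter) : Fires v (.inc c) (Function.update v c (v c + 1))
  | dec (c : Counter) (h : 0 < v c) : Fires v (.dec c) (Function.update v c (v c - 1))
  | skip : Fires v .skip v
  | isZero (c : Counter) (h : v c = 0) : Fires v (.isZero c) v
  | isPos (c : Counter) (h : 0 < v c) : Fires v (.isPos c) v

theorem exists_edge_of_step {M : List Command} {i j : ℕ} {v v' : Counter → ℕ}
    (h : Step M (i, v) (j, v')) : ∃ o, (i, j, o) ∈ edges M ∧ o.Fires v v' := by
  simp only [mem_edges]
  cases h with
  | inc h hi => exact ⟨_, ⟨_, h, by simp [commandEdges]⟩, .inc _⟩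
  | dec h hi hv => exact ⟨_, ⟨_, h, by simp [commandEdges]⟩, .dec _ hv⟩
  | goto h => exact ⟨_, ⟨_, h, by simp [commandEdges]⟩, .skip⟩
  | @jz_zero _ _ _ _ c h hv => exact ⟨.isZero c, ⟨_, h, by simp [commandEdges]⟩, .isZero _ hv⟩
  | @jz_pos _ _ _ _ c h hv => exact ⟨.isPos c, ⟨_, h, by simp [commandEdges]⟩, .isPos _ hv⟩

theorem step_of_edge {M : List Command} {i j : ℕ} {v v' : Counter → ℕ} {o : Op}
    (h : (i, j, o) ∈ edges M) (ho : o.Fires v v') (hj : j < M.length) : Step M (i, v) (j, v') := by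
  obtain ⟨l, hl, h⟩ := mem_edges.1 h
  cases ho <;> cases l <;> simp [commandEdges] at h
  · obtain ⟨rfl, rfl⟩ := h
    exact .inc hl hj
  · obtain ⟨rfl, rfl⟩ := h
    exact .dec hl hj ‹_›
  · subst h
    exact .goto hl
  · obtain ⟨rfl, rfl⟩ := h
    exact .jz_zero hl ‹_›
  · obtain ⟨rfl, rfl⟩ := h
    exact .jz_pos hl ‹_›

/-- The machine reaches a halt command with both counters zero from the given configuration. -/
inductive ZeroHaltsFrom (M : List Command) : Config → Prop
  | halt {j : ℕ} (h : M[j]? = some .halt) : ZeroHaltsFrom M (j, fun _ => 0)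
  | step {c c' : Config} (h : Step M c c') (h' : ZeroHaltsFrom M c') : ZeroHaltsFrom M c

theorem ZeroHaltsFrom.lt_length {M : List Command} {c : Config} (h : ZeroHaltsFrom M c) :
    c.1 < M.length := by
  cases h with
  | halt h => exact (List.getElem?_eq_some_iff.1 h).1
  | step h _ => cases h <;> exact (List.getElem?_eq_some_iff.1 ‹_›).1

theorem zeroHalts_iff {M : List Command} : ZeroHalts M ↔ ZeroHaltsFrom M (0, fun _ => 0) := by
  constructor
  · rintro ⟨r, j, ⟨-, hhead, hchain⟩, hlast, hj⟩
    have hne : r ≠ [] := by rintro rfl; simp at hhead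
    have h := List.relationReflTransGen_of_exists_isChain r hchain hne
    rw [List.head?_eq_some_head hne, Option.some_inj] at hhead
    rw [List.getLast?_eq_some_getLast hne, Option.some_inj] at hlast
    rw [hhead, hlast] at h
    generalize ((0, fun _ => 0) : Config) = c at h ⊢
    induction h using Relation.ReflTransGen.head_induction_on with
    | refl => exact .halt hj
    | head h _ ih => exact .step h ih
  · intro h
    suffices ∀ c, ZeroHaltsFrom M c → ∃ j, M[j]? = some .halt ∧
        Relation.ReflTransGen (Step M) c (j, fun _ => 0) by
      obtain ⟨j, hj, hr⟩ := this _ h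
      obtain ⟨l, hl, hlast⟩ := List.exists_isChain_cons_of_relationReflTransGen hr
      exact ⟨_, j, ⟨h.lt_length, rfl, hl⟩,
        by rw [List.getLast?_eq_some_getLast (List.cons_ne_nil _ _), hlast], hj⟩
    intro c h
    induction h with
    | halt h => exact ⟨_, h, .refl⟩
    | step h _ ih =>
      obtain ⟨j, hj, hr⟩ := ih
      exact ⟨j, hj, .head h hr⟩

/-! ## The automaton that searches for errors -/

/-- The state that checks, for `b = false`, that a counter is zero where it should be, and for
`b = true`, that it is positive where it should be. -/
def checkState : Counter → Bool → ℕ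
  | .x, false => 3
  | .x, true => 4
  | .y, false => 5
  | .y, true => 6

/-- The exponents of the loops on the states `3`, `4`, `5`, `6`. -/
def loopExponents : Op → List (Option (Fin 5))
  | .inc .x => [some 4, some 0, some 2, some 2]
  | .dec .x => [some 0, some 4, some 2, some 2]
  | .inc .y => [some 2, some 2, some 4, some 0]
  | .dec .y => [some 2, some 2, some 0, some 4]
  | .halt => []
  | _ => [some 2, some 2, some 2, some 2]

/-- The exponents of the transitions from the states `3`, `4`, `5`, `6` to the state `0`. -/
def exitExponents : Op → List (Option (Fin 5))
  | .isZero .x => [some 1]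
  | .isZero .y => [none, none, some 1]
  | .isPos .x => [none, some 3]
  | .dec .x => [none, some 3]
  | .isPos .y => [none, none, none, some 3]
  | .dec .y => [none, none, none, some 3]
  | .halt => [some 1, none, some 1, none]
  | _ => []

/-- Whether an operation is a halt. -/
def Op.isHalt : Op → Bool
  | .halt => true
  | _ => false

/-- The successor of the state that expects the location `i`, on a given edge. -/
def nextState (i : ℕ) (d : ℕ × ℕ × Op) : ℕ :=
  if d.1 = i then if d.2.2.isHalt = true then 2 else d.2.1 + 7 else 0

/-- The exponent of the transition from the state that expects the location `i`, on a given
edge. -/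
def nextExponent (i : ℕ) (d : ℕ × ℕ × Op) : Fin 5 :=
  if d.1 = i then if d.2.2.isHalt = true then 0 else 2 else 2

/-- The exponents of the transitions on a given edge: `0` is a sink, `1` the state before the first
letter of a path of control edges, `2` the state after a halt, `3`, `4`, `5`, `6` check the
counters, and `i + 7` expects an edge that leaves the location `i`. -/
def edgeExponent (p q : ℕ) (d : ℕ × ℕ × Op) : Option (Fin 5) :=
  if p = 0 then if q = 0 then some 2 else none
  else if p = 1 then if q = nextState 0 d then some (nextExponent 0 d + 1) else none
  else if p = 2 then if q = 0 then some 4 else none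
  else if p < 7 then
    if q = p then ((loopExponents d.2.2)[p - 3]?).bind id
    else if q = 0 then ((exitExponents d.2.2)[p - 3]?).bind id else none
  else if q = nextState (p - 7) d then some (nextExponent (p - 7) d) else none

/-- The exponents of the automaton that searches for errors; its letters are the indices of the
control edges. -/
def searchExponent (M : List Command) (p a q : ℕ) : Option (Fin 5) :=
  ((edges M)[a]?).bind (edgeExponent p q)

/-- Runs of the automaton that searches for errors. -/
abbrev SearchRun (M : List Command) : ℕ → List ℕ → ℤ → Prop :=
  ExponentRun (M.length + 8) (searchExponent M)

/-! ### Reading one letter in the search automaton -/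

section

variable {M : List Command} {a : ℕ} {w : List ℕ} {s : ℤ}

theorem searchRun_cons_iff {p : ℕ} {d : ℕ × ℕ × Op} (ha : (edges M)[a]? = some d) :
    SearchRun M p (a :: w) s ↔ ∃ q k, edgeExponent p q d = some k ∧ q < M.length + 8 ∧
      SearchRun M q w (s - ((k : ℕ) - 2)) := by
  simp [SearchRun, exponentRun_cons_iff, searchExponent, ha]

theorem searchRun_zero (hw : ∀ a ∈ w, a < (edges M).length) : SearchRun M 0 w s ↔ s = 0 := by
  induction w generalizing s with
  | nil => exact exponentRun_nil_iff
  | cons a w ih =>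
    rw [searchRun_cons_iff (List.getElem?_eq_getElem (hw a List.mem_cons_self))]
    have ih' := fun s => ih (s := s) fun b hb => hw b (List.mem_cons_of_mem _ hb)
    constructor
    · rintro ⟨q, k, he, -, h⟩
      simp only [edgeExponent, if_true] at he
      split_ifs at he with hq
      obtain rfl := Option.some_inj.1 he
      subst hq
      simpa using (ih' _).1 h
    · rintro rfl
      exact ⟨0, 2, rfl, by lia, (ih' _).2 (by simp)⟩

theorem searchRun_location {i : ℕ} {d : ℕ × ℕ × Op} (ha : (edges M)[a]? = some d) :
    SearchRun M (i + 7) (a :: w) s ↔ nextState i d < M.length + 8 ∧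
      SearchRun M (nextState i d) w (s - ((nextExponent i d : ℕ) - 2)) := by
  rw [searchRun_cons_iff ha]
  simp [edgeExponent]

/-- State `1` imitates the state `7`, which expects the first location, and adds the initial gain of
1. -/
theorem searchRun_start (ha : a < (edges M).length) :
    SearchRun M 1 (a :: w) s ↔ SearchRun M 7 (a :: w) (s - 1) := by
  have hd := List.getElem?_eq_getElem ha
  rw [searchRun_location (i := 0) hd, searchRun_cons_iff hd]
  -- The addition in `Fin 5` does not wrap around, because the exponent is 0 or 2.
  have hk : ((nextExponent 0 (edges M)[a] + 1 : Fin 5) : ℕ) = nextExponent 0 (edges M)[a] + 1 := by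
    unfold nextExponent
    split_ifs <;> rfl
  simp only [edgeExponent, one_ne_zero, if_false, if_true, ite_eq_iff, reduceCtorEq, and_false,
    or_false, Option.some_inj]
  constructor
  · rintro ⟨q, k, ⟨rfl, rfl⟩, hq, h⟩
    refine ⟨hq, ?_⟩
    convert h using 1
    rw [hk]; push_cast; ring
  · rintro ⟨hq, h⟩
    refine ⟨_, _, ⟨rfl, rfl⟩, hq, ?_⟩
    convert h using 1
    rw [hk]; push_cast; ring

theorem searchRun_halted (ha : a < (edges M).length) (hw : ∀ a ∈ w, a < (edges M).length) :
    SearchRun M 2 (a :: w) s ↔ s = 2 := by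
  rw [searchRun_cons_iff (List.getElem?_eq_getElem ha)]
  simp only [edgeExponent]
  constructor
  · rintro ⟨q, k, he, -, h⟩
    simp only [OfNat.ofNat_ne_zero, OfNat.ofNat_ne_one, if_false, if_true] at he
    split_ifs at he with hq
    obtain rfl := Option.some_inj.1 he
    subst hq
    have := (searchRun_zero hw).1 h
    simp at this
    lia
  · rintro rfl
    exact ⟨0, 4, rfl, by lia, (searchRun_zero hw).2 (by simp)⟩

theorem searchRun_check {c : Counter} {b : Bool} {i t : ℕ} {o : Op}
    (ha : (edges M)[a]? = some (i, t, o)) (hw : ∀ a ∈ w, a < (edges M).length) :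
    SearchRun M (checkState c b) (a :: w) s ↔
      (∃ k, (loopExponents o)[checkState c b - 3]? = some (some k) ∧
        SearchRun M (checkState c b) w (s - ((k : ℕ) - 2))) ∨
      ∃ k, (exitExponents o)[checkState c b - 3]? = some (some k) ∧ s = (k : ℕ) - 2 := by
  rw [searchRun_cons_iff ha]
  have h3 : 3 ≤ checkState c b ∧ checkState c b < 7 := by cases c <;> cases b <;> decide
  have he : ∀ q, edgeExponent (checkState c b) q (i, t, o) =
      if q = checkState c b then ((loopExponents o)[checkState c b - 3]?).bind id
      else if q = 0 then ((exitExponents o)[checkState c b - 3]?).bind id else none := by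
    intro q
    rw [edgeExponent, if_neg (by lia), if_neg (by lia), if_neg (by lia), if_pos h3.2]
  simp only [he]
  constructor
  · rintro ⟨q, k, hk, -, h⟩
    split_ifs at hk with h1 h2
    · subst h1
      exact .inl ⟨k, by simpa [Option.bind_eq_some_iff] using hk, h⟩
    · subst h2
      exact .inr ⟨k, by simpa [Option.bind_eq_some_iff] using hk,
        by have := (searchRun_zero hw).1 h; lia⟩
  · rintro (⟨k, hk, h⟩ | ⟨k, hk, rfl⟩)
    · exact ⟨checkState c b, k, by simp [hk], by lia, h⟩
    · exact ⟨0, k, by rw [if_neg (by lia)]; simp [hk], by lia,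
        (searchRun_zero hw).2 (by simp)⟩

end

/-- Twice a number, with the sign `+` for `true` and `-` for `false`. -/
def signedDouble (b : Bool) (n : ℕ) : ℤ := if b = true then 2 * n else -2 * n

/-- The signed double of the counter is a potential: the loop contributes exactly its decrease, so
bounds relative to the potential pass from one configuration to the next. -/
theorem exists_loopExponent {o : Op} {v v' : Counter → ℕ} (ho : o.Fires v v') (c : Counter)
    (b : Bool) : ∃ k : Fin 5, (loopExponents o)[checkState c b - 3]? = some (some k) ∧
      ((k : ℕ) - 2 : ℤ) = signedDouble b (v c) - signedDouble b (v' c) := by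
  cases ho with
  | inc c' =>
    cases c <;> cases c' <;> cases b <;>
      refine ⟨_, rfl, ?_⟩ <;> simp [signedDouble] <;> lia
  | dec c' h =>
    cases c <;> cases c' <;> cases b <;>
      refine ⟨_, rfl, ?_⟩ <;> simp [signedDouble] <;> lia
  | skip => cases c <;> cases b <;> exact ⟨2, rfl, by simp⟩
  | isZero c' h => cases c <;> cases b <;> exact ⟨2, rfl, by simp⟩
  | isPos c' h => cases c <;> cases b <;> exact ⟨2, rfl, by simp⟩

/-- A legal operation leaves no profitable exit: -1 is offered only to `false` with counter zero,
and +1 only to `true` with a positive counter. -/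
theorem exitExponent_le {o : Op} {v v' : Counter → ℕ} (ho : o.Fires v v') {c : Counter}
    {b : Bool} {k : Fin 5} (hk : (exitExponents o)[checkState c b - 3]? = some (some k)) :
    ((k : ℕ) - 2 : ℤ) ≤ signedDouble b (v c) - 1 := by
  cases ho with
  | inc c' => cases c' <;> simp [exitExponents] at hk
  | dec c' h =>
    cases c <;> cases c' <;> cases b <;> simp [exitExponents, checkState] at hk <;> subst hk <;>
      simp [signedDouble] <;> lia
  | skip => simp [exitExponents] at hk
  | isZero c' h =>
    cases c <;> cases c' <;> cases b <;> simp [exitExponents, checkState] at hk <;> subst hk <;>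
      simp [signedDouble] <;> lia
  | isPos c' h =>
    cases c <;> cases c' <;> cases b <;> simp [exitExponents, checkState] at hk <;> subst hk <;>
      simp [signedDouble] <;> lia

/-- By parity, the weak bound suffices: `-1 ≤ -2 * n` forces `n = 0`, and `1 ≤ 2 * n` forces `n >
0`. -/
theorem exists_fires_of_exitExponent_le {o : Op} (ho : o ≠ .halt) {v : Counter → ℕ}
    (h : ∀ c b (k : Fin 5), (exitExponents o)[checkState c b - 3]? = some (some k) →
      ((k : ℕ) - 2 : ℤ) ≤ signedDouble b (v c)) : ∃ v', o.Fires v v' := by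
  cases o with
  | inc c => exact ⟨_, .inc c⟩
  | dec c =>
    refine ⟨_, .dec c ?_⟩
    have := h c true 3 (by cases c <;> rfl)
    simp [signedDouble] at this
    lia
  | skip => exact ⟨_, .skip⟩
  | isZero c =>
    refine ⟨_, .isZero c ?_⟩
    have := h c false 1 (by cases c <;> rfl)
    simp [signedDouble] at this
    lia
  | isPos c =>
    refine ⟨_, .isPos c ?_⟩
    have := h c true 3 (by cases c <;> rfl)
    simp [signedDouble] at this
    lia
  | halt => exact absurd rfl ho

/-! ### Words without errors and 0-halting runs -/

section

variable {M : List Command} {w : List ℕ}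

/-- The word lists the edges of the halting run. The bound -2 is the loss at the final halt, before
the gain of state `1`; a counter check cannot survive that halt without exiting, which rules out
runs that only loop. -/
theorem exists_word_of_zeroHaltsFrom {c : Config} (h : ZeroHaltsFrom M c) :
    ∃ a w, (∀ b ∈ a :: w, b < (edges M).length) ∧
      (∀ s, SearchRun M (c.1 + 7) (a :: w) s → s ≤ -2) ∧
      ∀ d b s, SearchRun M (checkState d b) (a :: w) s → s ≤ signedDouble b (c.2 d) - 1 := by
  induction h with
  | @halt j h =>
    obtain ⟨a, ha⟩ := List.getElem?_of_mem (mem_edges.2 ⟨_, h, List.mem_singleton.2 rfl⟩)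
    have hlt := (List.getElem?_eq_some_iff.1 ha).1
    refine ⟨a, [], by simpa using hlt, fun s hs => ?_, fun d b s => ?_⟩
    · have := exponentRun_nil_iff.1 ((searchRun_location ha).1 hs).2
      simp [nextExponent, Op.isHalt] at this
      lia
    · rw [searchRun_check ha (by simp)]
      cases d <;> cases b <;>
        simp [loopExponents, exitExponents, checkState, signedDouble] <;> lia
  | @step c c' h h' ih =>
    obtain ⟨i, v⟩ := c
    obtain ⟨j, v'⟩ := c'
    obtain ⟨b, w, hw, hl, hc⟩ := ih
    obtain ⟨o, hmem, ho⟩ := exists_edge_of_step h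
    obtain ⟨a, ha⟩ := List.getElem?_of_mem hmem
    have hlt := (List.getElem?_eq_some_iff.1 ha).1
    refine ⟨a, b :: w, by simpa [hlt] using hw, fun s hs => ?_, fun d b s hs => ?_⟩
    · have hn : o.isHalt = false := by cases ho <;> rfl
      have := ((searchRun_location ha).1 hs).2
      simp only [nextState, nextExponent, hn] at this
      have := hl _ this
      simp at this
      lia
    · obtain ⟨k, hk, hr⟩ | ⟨k, hk, rfl⟩ := (searchRun_check ha hw).1 hs
      · obtain ⟨k', hk', he⟩ := exists_loopExponent ho d b
        obtain rfl : k' = k := by simpa [hk] using hk'.symm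
        have := hc d b _ hr
        simp only at this ⊢
        lia
      · exact exitExponent_le ho hk

/-- The hypotheses are the weak bounds, generalized to a suffix of the word read from the
configuration `(i, v)`. Each letter must then be a legal step, and the bounds are inherited by the
rest. -/
theorem zeroHaltsFrom_of_word (hM : IsTwoCounterMachine M) {i : ℕ} {v : Counter → ℕ}
    (hw : ∀ a ∈ w, a < (edges M).length) (hl : ∀ s, SearchRun M (i + 7) w s → s ≤ -1)
    (hc : ∀ c b s, SearchRun M (checkState c b) w s → s ≤ signedDouble b (v c)) :
    ZeroHaltsFrom M (i, v) := by
  induction w generalizing i v with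
  -- The word ended before a halt, so the path check kept its sum 0.
  | nil => exact absurd (hl 0 (.nil _)) (by lia)
  | cons a w ih =>
    have hw' := fun b hb => hw b (List.mem_cons_of_mem _ hb)
    obtain ⟨⟨j, t, o⟩, ha⟩ : ∃ d, (edges M)[a]? = some d :=
      ⟨_, List.getElem?_eq_getElem (hw a List.mem_cons_self)⟩
    have hmem := List.mem_of_getElem? ha
    have hexit : ∀ c b (k : Fin 5), (exitExponents o)[checkState c b - 3]? = some (some k) →
        ((k : ℕ) - 2 : ℤ) ≤ signedDouble b (v c) := fun c b k hk =>
      hc c b _ ((searchRun_check ha hw').2 (.inr ⟨k, hk, rfl⟩))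
    by_cases hj : j = i
    swap
    -- An edge that does not leave `i` sends the path check to the sink with sum 0.
    · have h0 := (searchRun_zero hw').2 rfl
      have := hl 0 ((searchRun_location ha).2
        ⟨by simp [nextState, hj], by simpa [nextState, nextExponent, hj] using h0⟩)
      lia
    subst hj
    by_cases ho : o = .halt
    · subst ho
      obtain rfl : w = [] := by
        rcases w with _ | ⟨b, w⟩
        · rfl
        -- A letter after the halt returns +2 and cancels the loss of 2.
        have h2 := (searchRun_halted (hw' b List.mem_cons_self)
          fun b hb => hw' b (List.mem_cons_of_mem _ hb)).2 rfl
        have := hl 0 ((searchRun_location ha).2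
          ⟨by simp [nextState, Op.isHalt], by simpa [nextState, nextExponent, Op.isHalt] using h2⟩)
        lia
      obtain rfl : v = fun _ => 0 := by
        funext c
        -- The exits at a halt give `-1 ≤ -2 * v c` for both counters.
        have := hexit c false 1 (by cases c <;> rfl)
        simp [signedDouble] at this
        lia
      obtain ⟨l, hl, h⟩ := mem_edges.1 hmem
      cases l <;> simp [commandEdges] at h
      exact .halt hl
    · obtain ⟨v', hv'⟩ := exists_fires_of_exitExponent_le ho hexit
      have hn : o.isHalt = false := by cases hv' <;> rfl
      have ht := target_le_of_mem_edges hM hmem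
      have hhalts : ZeroHaltsFrom M (t, v') := by
        refine ih hw' (fun s hs => hl s ((searchRun_location ha).2 ⟨?_, ?_⟩)) fun c b s hs => ?_
        · simp only [nextState, hn]
          simp; lia
        · simpa [nextState, nextExponent, hn] using hs
        · obtain ⟨k, hk, he⟩ := exists_loopExponent hv' c b
          have := hc c b (s + ((k : ℕ) - 2)) ((searchRun_check ha hw').2 (.inl ⟨k, hk, by simpa⟩))
          lia
      -- The target is a genuine location, rather than the one past the end, because the machine
      -- 0-halts from it.
      exact .step (step_of_edge hmem hv' hhalts.lt_length) hhalts

/-- The initial states of the automaton that searches for errors. -/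
def searchInitial : List ℕ := [1, 3, 4, 5, 6]

theorem checkState_mem_searchInitial (c : Counter) (b : Bool) : checkState c b ∈ searchInitial := by
  cases c <;> cases b <;> decide

theorem lt_of_mem_searchInitial (M : List Command) : ∀ p ∈ searchInitial, p < M.length + 8 := by
  simp [searchInitial]

theorem exists_word_of_zeroHalts (h : ZeroHalts M) : ∃ w, w ≠ [] ∧
    (∀ a ∈ w, a < (edges M).length) ∧ ∀ p ∈ searchInitial, ∀ s, SearchRun M p w s → s ≤ -1 := by
  obtain ⟨a, w, hw, hl, hc⟩ := exists_word_of_zeroHaltsFrom (zeroHalts_iff.1 h)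
  refine ⟨a :: w, by simp, hw, ?_⟩
  simp only [searchInitial, List.forall_mem_cons]
  refine ⟨fun s hs => ?_, hc .x false, hc .x true, hc .y false, hc .y true, by simp⟩
  have := hl _ ((searchRun_start (hw a List.mem_cons_self)).1 hs)
  lia

/-- At the start both counters are zero, so both potentials vanish and the bound `s ≤ 0` is exactly
what the counter checks need; the gain of state `1` turns it into `s ≤ -1` for the path check. -/
theorem zeroHalts_of_word (hM : IsTwoCounterMachine M) (hne : w ≠ [])
    (hw : ∀ a ∈ w, a < (edges M).length)
    (h : ∀ p ∈ searchInitial, ∀ s, SearchRun M p w s → s ≤ 0) : ZeroHalts M := by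
  refine zeroHalts_iff.2 (zeroHaltsFrom_of_word hM hw (fun s hs => ?_) fun c b s hs => ?_)
  · obtain ⟨a, w, rfl⟩ := List.exists_cons_of_ne_nil hne
    have := h 1 (by decide) (s + 1)
      ((searchRun_start (hw a List.mem_cons_self)).2 (by simpa using hs))
    lia
  · have := h _ (checkState_mem_searchInitial c b) s hs
    simpa [signedDouble] using this

end

end CounterMachine

/-! ## Computability of the construction -/

theorem Primrec.filterMap_range {α σ : Type*} [Primcodable α] [Primcodable σ] {f : α → ℕ}
    {g : α → ℕ → Option σ} (hf : Primrec f) (hg : Primrec₂ g) :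
    Primrec fun a => (List.range (f a)).filterMap (g a) :=
  .listFilterMap (.comp .list_range hf) hg

theorem Primrec.flatMap_range {α σ : Type*} [Primcodable α] [Primcodable σ] {f : α → ℕ}
    {g : α → ℕ → List σ} (hf : Primrec f) (hg : Primrec₂ g) :
    Primrec fun a => (List.range (f a)).flatMap (g a) :=
  .list_flatMap (.comp .list_range hf) hg

theorem NMDA.primrec_exponentCode {α : Type*} [Primcodable α] {L N : α → ℕ} (I : List ℕ)
    {e : α → ℕ → ℕ → ℕ → Option (Fin 5)} (hL : Primrec L) (hN : Primrec N)
    (he : Primrec fun x : ((α × ℕ) × ℕ) × ℕ => e x.1.1.1 x.1.1.2 x.1.2 x.2) :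
    Primrec fun x => exponentCode (L x) (N x) I (e x) := by
  -- Only five exponents occur, so the rational arithmetic is a finite table.
  have hentry : Primrec exponentEntry := .dom_finite _
  refine .pair (.comp .list_range hL) (.pair (.comp .list_range hN) (.pair (.const I) ?_))
  refine .flatMap_range hN (Primrec.flatMap_range (hL.comp .fst) (Primrec.filterMap_range
    (hN.comp (.comp .fst .fst)) (Primrec.option_map he ?_)))
  exact Primrec.pair (.comp .snd (.comp .fst (.comp .fst .fst)))
    (.pair (.comp .snd (.comp .fst .fst)) (.pair (.comp .snd .fst) (hentry.comp .snd)))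

namespace CounterMachine

theorem primrec_commandEdges : Primrec₂ commandEdges := by
  have hop : ∀ {α : Type} [Primcodable α] {f : α → Counter} (g : Counter → Op), Primrec f →
      Primrec fun a => g (f a) := fun g hf => (Primrec.dom_finite g).comp hf
  have hnil : ∀ {α : Type} [Primcodable α] {f : α → ℕ × ℕ × Op}, Primrec f →
      Primrec fun a => [f a] := fun hf => Primrec.list_cons.comp hf (.const [])
  have hcmd : Primrec fun x : ℕ × Command => commandEquiv x.2 :=
    Primrec.comp (Primrec.of_equiv (e := commandEquiv)) Primrec.snd
  refine (Primrec.sumCasesOn hcmd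
    (g := fun x c => [(x.1, x.1 + 1, Op.inc c)])
    (h := fun x s => Sum.casesOn s (fun c => [(x.1, x.1 + 1, Op.dec c)]) fun s =>
      Sum.casesOn s (fun k => [(x.1, k, Op.skip)]) fun s =>
      Sum.casesOn s (fun j => [(x.1, j.2.1, Op.isZero j.1), (x.1, j.2.2, Op.isPos j.1)]) fun _ =>
      [(x.1, x.1, Op.halt)]) ?_ ?_).of_eq ?_
  · exact hnil (.pair (.comp .fst .fst) (.pair (Primrec.succ.comp (.comp .fst .fst))
      (hop _ .snd)))
  · refine Primrec.sumCasesOn .snd ?_ ?_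
    · exact hnil (.pair (.comp .fst (.comp .fst .fst))
        (.pair (Primrec.succ.comp (.comp .fst (.comp .fst .fst))) (hop _ .snd)))
    refine Primrec.sumCasesOn .snd ?_ ?_
    · exact hnil (.pair (.comp .fst (.comp .fst (.comp .fst .fst)))
        (.pair .snd (.const _)))
    refine Primrec.sumCasesOn .snd ?_ ?_
    · have hi : Primrec fun x : ((((ℕ × Command) × (Counter ⊕ ℕ ⊕ (Counter × ℕ × ℕ) ⊕ Unit)) ×
          (ℕ ⊕ (Counter × ℕ × ℕ) ⊕ Unit)) × ((Counter × ℕ × ℕ) ⊕ Unit)) × Counter × ℕ × ℕ =>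
          x.1.1.1.1.1 := .comp .fst (.comp .fst (.comp .fst (.comp .fst .fst)))
      exact Primrec.list_cons.comp
        (.pair hi (.pair (.comp .fst (.comp .snd .snd)) (hop _ (.comp .fst .snd))))
        (hnil (.pair hi (.pair (.comp .snd (.comp .snd .snd)) (hop _ (.comp .fst .snd)))))
    · have hi : Primrec fun x : ((((ℕ × Command) × (Counter ⊕ ℕ ⊕ (Counter × ℕ × ℕ) ⊕ Unit)) ×
          (ℕ ⊕ (Counter × ℕ × ℕ) ⊕ Unit)) × ((Counter × ℕ × ℕ) ⊕ Unit)) × Unit =>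
          x.1.1.1.1.1 := .comp .fst (.comp .fst (.comp .fst (.comp .fst .fst)))
      exact hnil (.pair hi (.pair hi (.const _)))
  · rintro ⟨i, l⟩
    cases l <;> rfl

theorem primrec_edges : Primrec edges := by
  have h : Primrec₂ fun (x : List Command × ℕ) l => commandEdges x.2 l :=
    primrec_commandEdges.comp (.comp .snd .fst) .snd
  refine .flatMap_range .list_length <| (Primrec.option_casesOn
    (Primrec.list_getElem?.comp .fst .snd) (.const []) h).of_eq ?_
  rintro ⟨M, i⟩
  simp only
  cases M[i]? <;> rfl

theorem primrec_edgeExponent :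
    Primrec fun x : (ℕ × ℕ) × ℕ × ℕ × Op => edgeExponent x.1.1 x.1.2 x.2 := by
  have hp : Primrec fun x : (ℕ × ℕ) × ℕ × ℕ × Op => x.1.1 := .comp .fst .fst
  have hq : Primrec fun x : (ℕ × ℕ) × ℕ × ℕ × Op => x.1.2 := .comp .snd .fst
  have ho : Primrec fun x : (ℕ × ℕ) × ℕ × ℕ × Op => x.2.2.2 := .comp .snd (.comp .snd .snd)
  have hh : PrimrecPred fun x : (ℕ × ℕ) × ℕ × ℕ × Op => x.2.2.2.isHalt = true :=
    Primrec.eq.comp ((Primrec.dom_finite Op.isHalt).comp ho) (.const true)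
  have hs : ∀ {f : (ℕ × ℕ) × ℕ × ℕ × Op → ℕ}, Primrec f →
      Primrec fun x => nextState (f x) x.2 := fun hf =>
    .ite (Primrec.eq.comp (.comp .fst .snd) hf) (.ite hh (.const 2)
      (Primrec.nat_add.comp (.comp .fst (.comp .snd .snd)) (.const 7))) (.const 0)
  have he : ∀ {f : (ℕ × ℕ) × ℕ × ℕ × Op → ℕ}, Primrec f →
      Primrec fun x => nextExponent (f x) x.2 := fun hf =>
    .ite (Primrec.eq.comp (.comp .fst .snd) hf) (.ite hh (.const 0) (.const 2)) (.const 2)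
  have hsub : ∀ n, Primrec fun x : (ℕ × ℕ) × ℕ × ℕ × Op => x.1.1 - n := fun n =>
    Primrec.nat_sub.comp hp (.const n)
  have htab : ∀ f : Op → List (Option (Fin 5)),
      Primrec fun x : (ℕ × ℕ) × ℕ × ℕ × Op => ((f x.2.2.2)[x.1.1 - 3]?).bind id := fun f =>
    .option_bind (Primrec.list_getElem?.comp ((Primrec.dom_finite f).comp ho) (hsub 3)) .snd
  have hsucc : Primrec fun k : Fin 5 => k + 1 := .dom_finite _
  refine .ite (Primrec.eq.comp hp (.const 0)) (.ite (Primrec.eq.comp hq (.const 0)) (.const _)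
    (.const _)) (.ite (Primrec.eq.comp hp (.const 1)) (.ite (Primrec.eq.comp hq (hs (.const 0)))
    (Primrec.option_some.comp (hsucc.comp (he (.const 0)))) (.const _))
    (.ite (Primrec.eq.comp hp (.const 2)) (.ite (Primrec.eq.comp hq (.const 0)) (.const _)
    (.const _)) (.ite (Primrec.nat_lt.comp hp (.const 7)) (.ite (Primrec.eq.comp hq hp) (htab _)
    (.ite (Primrec.eq.comp hq (.const 0)) (htab _) (.const _)))
    (.ite (Primrec.eq.comp hq (hs (hsub 7))) (Primrec.option_some.comp (he (hsub 7)))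
    (.const _)))))

theorem primrec_searchExponent :
    Primrec fun x : ((List Command × ℕ) × ℕ) × ℕ =>
      searchExponent x.1.1.1 x.1.1.2 x.1.2 x.2 := by
  have hM : Primrec fun x : ((List Command × ℕ) × ℕ) × ℕ => x.1.1.1 := .comp .fst (.comp .fst .fst)
  have hp : Primrec fun x : ((List Command × ℕ) × ℕ) × ℕ => x.1.1.2 := .comp .snd (.comp .fst .fst)
  have ha : Primrec fun x : ((List Command × ℕ) × ℕ) × ℕ => x.1.2 := .comp .snd .fst
  have hd : Primrec fun x : ((List Command × ℕ) × ℕ) × ℕ => (edges x.1.1.1)[x.1.2]? :=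
    Primrec.list_getElem?.comp (primrec_edges.comp hM) ha
  have he : Primrec₂ fun (x : ((List Command × ℕ) × ℕ) × ℕ) d => edgeExponent x.1.1.2 x.2 d :=
    primrec_edgeExponent.comp (.pair (.pair (hp.comp .fst) (.comp .snd .fst)) .snd)
  exact .option_bind hd he

end CounterMachine

open CounterMachine NMDA in
theorem mainTheorem6 :
    ∃ f : List CounterMachine.Command → NMDACode × NMDACode, Computable f ∧
      ∀ M : List CounterMachine.Command, CounterMachine.IsTwoCounterMachine M →
        ∃ A B : NMDA ℕ ℕ, (f M).1.Describes A ∧ (f M).2.Describes B ∧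
          A.alphabet = B.alphabet ∧
          A.IsIntegral ∧ A.IsDeterministic ∧ B.IsIntegral ∧
          (CounterMachine.ZeroHalts M ↔ ∃ w : List ℕ, A.IsNonemptyWord w ∧ A.value w ≤ B.value w) ∧
          (CounterMachine.ZeroHalts M ↔ ∃ w : List ℕ, A.IsNonemptyWord w ∧ A.value w < B.value w) := by
  refine ⟨fun M => (exponentCode (edges M).length 1 [0] fun _ _ _ => some 2,
    exponentCode (edges M).length (M.length + 8) searchInitial (searchExponent M)), ?_, ?_⟩
  · have hL : Primrec fun M => (edges M).length := Primrec.list_length.comp primrec_edges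
    exact (Primrec.pair (primrec_exponentCode _ hL (.const 1) (.const _)) (primrec_exponentCode _ hL
      (Primrec.nat_add.comp .list_length (.const 8)) primrec_searchExponent)).to_comp
  · intro M hM
    -- The equivalences close as a cycle: 0-halting gives the strict inequality, hence the weak one,
    -- hence 0-halting.
    have h3 : ZeroHalts M → ∃ w : List ℕ, (constant (edges M).length).IsNonemptyWord w ∧
        (constant (edges M).length).value w < (ofExponents (edges M).length (M.length + 8)
          searchInitial (searchExponent M) (lt_of_mem_searchInitial M)).value w := by
      intro h
      obtain ⟨w, hne, hw, hs⟩ := exists_word_of_zeroHalts h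
      exact ⟨w, ⟨hne, fun a ha => Finset.mem_range.2 (hw a ha)⟩,
        value_constant_lt_value_ofExponents hw hs⟩
    have h1 : (∃ w : List ℕ, (constant (edges M).length).IsNonemptyWord w ∧
        (constant (edges M).length).value w ≤ (ofExponents (edges M).length (M.length + 8)
          searchInitial (searchExponent M) (lt_of_mem_searchInitial M)).value w) →
        ZeroHalts M := by
      rintro ⟨w, ⟨hne, hw⟩, h⟩
      have hw' : ∀ a ∈ w, a < (edges M).length := fun a ha => Finset.mem_range.1 (hw a ha)
      exact zeroHalts_of_word hM hne hw' fun p hp s hs => le_zero_of_value_constant_le hw' h hp hs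
    exact ⟨_, _, exponentCode_describes, exponentCode_describes, rfl, ofExponents_isIntegral,
      constant_isDeterministic _, ofExponents_isIntegral,
      ⟨fun h => (h3 h).imp fun w hw => ⟨hw.1, hw.2.le⟩, h1⟩,
      ⟨h3, fun ⟨w, hw, h⟩ => h1 ⟨w, hw, h.le⟩⟩⟩
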